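/- Let $w$ be a binary word (a finite word over the alphabet $\{0,1\}$) with $r$ letters. For an integer $n\ge 1$ let $a_w(n)$ be the number of (possibly overlapping) occurrences of $w$ as a block of consecutive digits in the binary expansion of $n$, with the following convention: if $w$ begins with $0$ and is not of the form $0^{\ell}$ (that is, $w$ contains at least one letter $1$), the binary expansion of $n$ is taken to be preceded by infinitely many digits $0$; in all other cases it is the usual binary expansion, beginning with $1$. (For example, $a_{01}(5)=2$ and $a_{000}(8)=1$.) Then for every $k\ge 0$ the series $\sum_{n\ge 1,\ a_w(n)=k} \frac1n$ converges, and $$\lim_{k\to\infty}\ \sum_{\substack{n\ge 1\\ a_w(n)=k}}\frac1n \;=\; 2^r\log 2 .$$ For example, for $w=11$ the limit is $4\log 2$. -/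

import Mathlib

/-- The binary word `w` (most significant letter first, `true` is the letter `1`) occurs in the
binary expansion of `n`, preceded by infinitely many zeros, with its last letter at the digit
of weight `2 ^ i`. -/
def OccursAt (w : List Bool) (n i : ℕ) : Prop :=
  ∀ (j : ℕ) (hj : j < w.reverse.length), w.reverse[j] = n.testBit (i + j)

open Classical in
/-- The number of (possibly overlapping) occurrences of the binary word `w` in the binary expansion
of `n`. If `w` begins with `0` and contains a letter `1`, the expansion of `n` is preceded by
infinitely many zeros; otherwise it is the usual expansion, with `Nat.size n` digits, the
first of which is `1`. -/
noncomputable def wordCount (w : List Bool) (n : ℕ) : ℕ :=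
  if w.head? = some false ∧ true ∈ w then
    {i : ℕ | OccursAt w n i}.ncard
  else
    {i : ℕ | i + w.length ≤ Nat.size n ∧ OccursAt w n i}.ncard

/-- A word containing a letter `1` has only finitely many occurrences, even when the expansion is
preceded by infinitely many zeros. -/
theorem finite_setOf_occursAt (w : List Bool) (hw : true ∈ w) (n : ℕ) :
    {i : ℕ | OccursAt w n i}.Finite := by
  obtain ⟨j, hj, h⟩ := List.getElem_of_mem (List.mem_reverse.2 hw)
  refine (Set.finite_lt_nat n.size).subset fun i hi => ?_
  have h1 := hi j hj
  rw [h] at h1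
  by_contra hlt
  have hlt : n.size ≤ i := not_lt.1 hlt
  have h2 : n < 2 ^ (i + j) :=
    (Nat.lt_size_self n).trans_le (Nat.pow_le_pow_right (by norm_num) (by omega))
  rw [Nat.testBit_lt_two_pow h2] at h1
  exact absurd h1 (by decide)

/-! Deleting the last binary digit gives `a n = a (n / 2) + [n ≡ v mod 2 ^ r]`, and only this
recursion is used afterwards. Let `T k` and `S k` be the sums of `1 / n` over the level `a n = k`,
restricted to `n ≡ v mod 2 ^ r` and unrestricted. Grouping `n` by `m = n / 2`, the recursion gives
`T k - T (k + 1) = ∑ d m` over `a m = k`, where `d m = 1/m - 1/(2m) - 1/(2m+1)`. Since `T 0 = 0`,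
this telescopes to `T k = -∑ d m` over `a m < k`, which tends to `-∑ d m = log 2`
(`tendsto_levelSum_block`). Hence `T k - T (k + 1)` tends to `0`: for large `k`, levels are almost
unaffected by appending a digit, so each residue class modulo `2 ^ r` carries asymptotically the
same weight (`tendsto_mul_levelSum_sub`). Thus `S k - 2 ^ r * T k` tends to `0`. -/

open Filter Topology

/-! ### Digit recursion for the occurrence count -/

section WordCount

theorem exists_occursAt_zero_iff (w : List Bool) :
    ∃ v < 2 ^ w.length, ∀ n, OccursAt w n 0 ↔ n % 2 ^ w.length = v := by
  have hlen : w.reverse.length = w.length := List.length_reverse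
  refine ⟨Nat.ofBits fun j : Fin w.length => w.reverse[(j : ℕ)]'(by simp),
    Nat.ofBits_lt_two_pow _, fun n => ⟨fun h => ?_, fun h j hj => ?_⟩⟩
  · refine Nat.eq_of_testBit_eq fun j => ?_
    rw [Nat.testBit_mod_two_pow]
    by_cases hj : j < w.length
    · have := h j (hlen ▸ hj)
      rw [Nat.testBit_ofBits_lt _ _ hj]
      simp only [zero_add] at this
      simp [hj, this]
    · rw [Nat.testBit_ofBits_ge _ _ (not_lt.1 hj)]
      simp [hj]
  · have hj' : j < w.length := hlen ▸ hj
    have h1 := congrArg (fun m => Nat.testBit m j) h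
    simp only [Nat.testBit_mod_two_pow, Nat.testBit_ofBits_lt _ _ hj'] at h1
    simpa [hj'] using h1.symm

theorem occursAt_succ_iff (w : List Bool) (n i : ℕ) :
    OccursAt w n (i + 1) ↔ OccursAt w (n / 2) i := by
  unfold OccursAt
  simp only [Nat.testBit_div_two]
  simp only [add_right_comm]

/-- A word overrunning the expansion would have to begin with `0`, hence be all zeros, forcing `n =
0`. So the length constraint in the count is automatic at position `0`. -/
theorem OccursAt.length_le_size {w : List Bool} {n : ℕ} (hn : 1 ≤ n)
    (hw : ¬(w.head? = some false ∧ true ∈ w)) (h : OccursAt w n 0) : w.length ≤ n.size := by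
  cases w with
  | nil => simp
  | cons c w =>
    by_contra hlt
    have hlt : n.size ≤ w.length := by simpa using hlt
    have h0 : n.testBit w.length = false :=
      Nat.testBit_lt_two_pow ((Nat.size_le).1 hlt)
    have hc : c = false := by
      have := h w.length (by simp)
      simpa [h0] using this
    subst hc
    have hall : ∀ b ∈ false :: w, b = false := by
      intro b hb
      cases b with
      | false => rfl
      | true => exact absurd ⟨rfl, hb⟩ hw
    refine (Nat.one_le_iff_ne_zero.1 hn) (Nat.eq_of_testBit_eq fun j => ?_)
    rw [Nat.zero_testBit]
    by_cases hj : j < w.length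
    · have := h j (by simp; omega)
      rw [zero_add] at this
      rw [← this]
      exact hall _ (List.mem_reverse.1 (List.getElem_mem _))
    · exact Nat.testBit_lt_two_pow ((Nat.size_le).1 (le_trans ‹n.size ≤ w.length› (not_lt.1 hj)))

theorem ncard_eq_ncard_preimage_succ_add {s : Set ℕ} (hs : s.Finite) [Decidable (0 ∈ s)] :
    s.ncard = {i | i + 1 ∈ s}.ncard + if 0 ∈ s then 1 else 0 := by
  have himg : ((fun i => i + 1) '' {i | i + 1 ∈ s}).ncard = {i | i + 1 ∈ s}.ncard :=
    Set.ncard_image_of_injective _ (add_left_injective 1)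
  rw [← himg]
  split_ifs with h0
  · rw [← Set.ncard_insert_of_notMem (a := 0) (by simp)
      (hs.subset (by rintro _ ⟨i, hi, rfl⟩; exact hi))]
    congr 1
    ext i
    cases i <;> simp [h0]
  · rw [add_zero]
    congr 1
    ext i
    cases i <;> simp [h0]

theorem size_eq_size_div_two_add_one {n : ℕ} (hn : 1 ≤ n) : n.size = (n / 2).size + 1 := by
  refine eq_of_forall_ge_iff fun m => ?_
  cases m with
  | zero => simpa [Nat.size_eq_zero] using Nat.one_le_iff_ne_zero.1 hn
  | succ m =>
    rw [Nat.size_le, Nat.add_le_add_iff_right, Nat.size_le, pow_succ]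
    omega

open Classical in
theorem wordCount_eq_wordCount_div_two_add (w : List Bool) {n : ℕ} (hn : 1 ≤ n) :
    wordCount w n = wordCount w (n / 2) + if OccursAt w n 0 then 1 else 0 := by
  unfold wordCount
  split_ifs with hw h0 h0
  · rw [ncard_eq_ncard_preimage_succ_add (finite_setOf_occursAt w hw.2 n)]
    simp [occursAt_succ_iff, h0]
  · rw [ncard_eq_ncard_preimage_succ_add (finite_setOf_occursAt w hw.2 n)]
    simp [occursAt_succ_iff, h0]
  all_goals
    rw [ncard_eq_ncard_preimage_succ_add
      ((Set.finite_le_nat n.size).subset fun i hi => (Nat.le_add_right _ _).trans hi.1)]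
    simp only [Set.mem_ofPred_eq, occursAt_succ_iff, size_eq_size_div_two_add_one hn, h0,
      and_false, and_true, if_false, add_right_comm _ 1, Nat.add_le_add_iff_right, zero_add]
  rw [if_pos]
  rw [← size_eq_size_div_two_add_one hn]
  exact h0.length_le_size hn hw

end WordCount

/-- `a` satisfies the recursion of a counter of the binary digit blocks of length `r` with
value `v`. -/
def IsBlockCounter (a : ℕ → ℕ) (r v : ℕ) : Prop :=
  ∀ n, 1 ≤ n → a n = a (n / 2) + if n % 2 ^ r = v then 1 else 0

/-- The term `1 / n`, kept when `a n = k` and `n ≡ u` modulo `q`. -/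
noncomputable def levelTerm (a : ℕ → ℕ) (q u k n : ℕ) : ℝ :=
  if n % q = u ∧ a n = k then (n : ℝ)⁻¹ else 0

/-- The sum of `1 / n` over the `n` with `a n = k` and `n ≡ u` modulo `q`. -/
noncomputable def levelSum (a : ℕ → ℕ) (q u k : ℕ) : ℝ :=
  ∑' n, levelTerm a q u k n

/-! ### Convergence on each level -/

namespace IsBlockCounter

variable {a : ℕ → ℕ} {r v : ℕ}

theorem apply_div_two_le (ha : IsBlockCounter a r v) (n : ℕ) : a (n / 2) ≤ a n := by
  rcases Nat.eq_zero_or_pos n with rfl | hn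
  · simp
  · rw [ha n hn]; omega

theorem apply_div_two_pow_le (ha : IsBlockCounter a r v) (n j : ℕ) : a (n / 2 ^ j) ≤ a n := by
  induction j with
  | zero => simp
  | succ j ih =>
    rw [pow_succ, ← Nat.div_div_eq_div_mul]
    exact (ha.apply_div_two_le _).trans ih

/-- The exponent `r + 1` guarantees at least one halving, even for the empty word. -/
theorem apply_succ_le_of_mod (ha : IsBlockCounter a r v) (hv : v < 2 ^ r) {n : ℕ} (hn : 1 ≤ n)
    (h : n % 2 ^ (r + 1) = v) : a (n / 2 ^ (r + 1)) + 1 ≤ a n := by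
  have h1 : n % 2 ^ r = v := by
    rw [← Nat.mod_mod_of_dvd n (pow_dvd_pow 2 (Nat.le_succ r)), h, Nat.mod_eq_of_lt hv]
  rw [ha n hn, if_pos h1, pow_succ', ← Nat.div_div_eq_div_mul]
  exact Nat.succ_le_succ (ha.apply_div_two_pow_le _ _)

/-- Partial sums of `1 / n` over the `n` with `a n < k`. -/
noncomputable def partialSum (a : ℕ → ℕ) (k M : ℕ) : ℝ :=
  ∑ n ∈ Finset.range M, if a n < k then (n : ℝ)⁻¹ else 0

/-- Each `m ≥ 1` has `L = 2 ^ (r + 1)` extensions `L * m + u`, of weight at most `1 / (L * m)`. All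
have level at least `a m`, and the extension `u = v` gains at least one. The constant `L * L` covers
the extensions of `m = 0`. -/
theorem partialSum_mul_le (ha : IsBlockCounter a r v) (hv : v < 2 ^ r) (k M : ℕ) :
    2 ^ (r + 1) * partialSum a (k + 1) (2 ^ (r + 1) * (M + 1)) ≤
      2 ^ (r + 1) * 2 ^ (r + 1) + (2 ^ (r + 1) - 1) * partialSum a (k + 1) (M + 1)
        + partialSum a k (M + 1) := by
  have hv' : v < 2 ^ (r + 1) := hv.trans_le (Nat.pow_le_pow_right two_pos (Nat.le_succ r))
  set L := 2 ^ (r + 1) with hL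
  have hLR : (2 : ℝ) ^ (r + 1) = (L : ℝ) := by rw [hL]; push_cast; rfl
  have hLpos : 0 < L := by positivity
  have hLpos' : (0 : ℝ) < L := by exact_mod_cast hLpos
  rw [hLR]
  unfold partialSum
  induction M with
  | zero =>
    have h1 : ∑ n ∈ Finset.range (L * (0 + 1)), (if a n < k + 1 then (n : ℝ)⁻¹ else 0) ≤ L := by
      calc _ ≤ ∑ n ∈ Finset.range (L * (0 + 1)), (1 : ℝ) := by
            refine Finset.sum_le_sum fun n _ => ?_
            split_ifs
            · exact Nat.cast_inv_le_one n
            · exact zero_le_one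
        _ = L := by simp
    simp only [zero_add, Finset.sum_range_one, Nat.cast_zero, inv_zero, ite_self, mul_zero,
      add_zero] at h1 ⊢
    gcongr
  | succ M ih =>
    rw [mul_add L (M + 1) 1, mul_one, Finset.sum_range_add, mul_add,
      Finset.sum_range_succ _ (M + 1), Finset.sum_range_succ _ (M + 1)]
    have key : (L : ℝ) * ∑ u ∈ Finset.range L,
        (if a (L * (M + 1) + u) < k + 1 then ((L * (M + 1) + u : ℕ) : ℝ)⁻¹ else 0) ≤
        (L - 1) * (if a (M + 1) < k + 1 then ((M + 1 : ℕ) : ℝ)⁻¹ else 0)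
          + if a (M + 1) < k then ((M + 1 : ℕ) : ℝ)⁻¹ else 0 := by
      have hbound : ∀ u : ℕ, (L : ℝ) * ((L * (M + 1) + u : ℕ) : ℝ)⁻¹ ≤ ((M + 1 : ℕ) : ℝ)⁻¹ := by
        intro u
        rw [← div_eq_mul_inv, div_le_iff₀ (by push_cast; positivity), ← div_eq_inv_mul,
          le_div_iff₀ (by positivity)]
        push_cast
        linarith [Nat.cast_nonneg (α := ℝ) u]
      have hmod : ∀ u < L, (L * (M + 1) + u) % L = u := fun u hu => by
        rw [Nat.mul_add_mod, Nat.mod_eq_of_lt hu]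
      have hdiv : ∀ u < L, (L * (M + 1) + u) / L = M + 1 := fun u hu => by
        rw [Nat.mul_add_div hLpos, Nat.div_eq_of_lt hu, add_zero]
      have hterm : ∀ u ∈ (Finset.range L).erase v, (L : ℝ) *
          (if a (L * (M + 1) + u) < k + 1 then ((L * (M + 1) + u : ℕ) : ℝ)⁻¹ else 0) ≤
          if a (M + 1) < k + 1 then ((M + 1 : ℕ) : ℝ)⁻¹ else 0 := by
        intro u hu
        have hu' : u < L := Finset.mem_range.1 (Finset.mem_of_mem_erase hu)
        have hle := ha.apply_div_two_pow_le (L * (M + 1) + u) (r + 1)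
        rw [← hL, hdiv u hu'] at hle
        by_cases h : a (L * (M + 1) + u) < k + 1
        · rw [if_pos h, if_pos (by omega)]
          exact hbound u
        · rw [if_neg h, mul_zero]
          positivity
      have htermv : (L : ℝ) *
          (if a (L * (M + 1) + v) < k + 1 then ((L * (M + 1) + v : ℕ) : ℝ)⁻¹ else 0) ≤
          if a (M + 1) < k then ((M + 1 : ℕ) : ℝ)⁻¹ else 0 := by
        have hle := ha.apply_succ_le_of_mod hv (n := L * (M + 1) + v)
          (Nat.add_pos_left (Nat.mul_pos hLpos (Nat.succ_pos M)) v) (hmod v hv')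
        rw [← hL, hdiv v hv'] at hle
        by_cases h : a (L * (M + 1) + v) < k + 1
        · rw [if_pos h, if_pos (by omega)]
          exact hbound v
        · rw [if_neg h, mul_zero]
          positivity
      rw [← Finset.sum_erase_add _ _ (Finset.mem_range.2 hv'), mul_add, Finset.mul_sum]
      refine add_le_add ((Finset.sum_le_card_nsmul _ _ _ hterm).trans_eq ?_) htermv
      rw [Finset.card_erase_of_mem (Finset.mem_range.2 hv'), Finset.card_range, nsmul_eq_mul,
        Nat.cast_pred hLpos]
    linarith

theorem partialSum_le (ha : IsBlockCounter a r v) (hv : v < 2 ^ r) (k M : ℕ) :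
    partialSum a k M ≤ k * (2 ^ (r + 1) * 2 ^ (r + 1)) := by
  induction k generalizing M with
  | zero => simp [partialSum]
  | succ k ih =>
    have hmono : ∀ {M N : ℕ}, M ≤ N → partialSum a (k + 1) M ≤ partialSum a (k + 1) N := by
      intro M N h
      exact Finset.sum_le_sum_of_subset_of_nonneg (Finset.range_mono h)
        fun _ _ _ => by positivity
    have hL : (1 : ℝ) ≤ 2 ^ (r + 1) := one_le_pow₀ one_le_two
    have h1 := ha.partialSum_mul_le hv k M
    have h2 : partialSum a (k + 1) (M + 1) ≤ partialSum a (k + 1) (2 ^ (r + 1) * (M + 1)) :=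
      hmono (Nat.le_mul_of_pos_left _ (by positivity))
    have h3 := mul_le_mul_of_nonneg_left h2 (zero_le_one.trans hL)
    have h4 := hmono (Nat.le_succ M)
    have h5 := ih (M + 1)
    push_cast
    linarith

theorem summable_levelTerm (ha : IsBlockCounter a r v) (hv : v < 2 ^ r) (q u k : ℕ) :
    Summable (levelTerm a q u k) := by
  refine summable_of_sum_range_le (c := ((k + 1 : ℕ) : ℝ) * (2 ^ (r + 1) * 2 ^ (r + 1)))
    (fun n => by unfold levelTerm; positivity) fun M => ?_
  refine le_trans (Finset.sum_le_sum fun n _ => ?_) (ha.partialSum_le hv (k + 1) M)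
  unfold levelTerm
  by_cases h : n % q = u ∧ a n = k
  · rw [if_pos h, if_pos (by omega)]
  · rw [if_neg h]
    positivity

/-! ### Harmonic estimates -/

/-- Restricted to a level `a m = k`, an absolutely convergent series tends to `0`. -/
theorem tendsto_tsum_level_zero (a : ℕ → ℕ) {d : ℕ → ℝ} (hd : Summable d) (p : ℕ → Prop)
    [DecidablePred p] :
    Tendsto (fun k => ∑' m, if p m ∧ a m = k then d m else 0) atTop (𝓝 0) := by
  suffices h : Tendsto (fun k => ∑' m, if p m ∧ a m = k then d m else 0) atTop
      (𝓝 (∑' _ : ℕ, (0 : ℝ))) by rwa [tsum_zero] at h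
  refine tendsto_tsum_of_dominated_convergence hd.norm (fun m => ?_) (Eventually.of_forall ?_)
  · refine tendsto_const_nhds.congr' ?_
    filter_upwards [eventually_gt_atTop (a m)] with k hk
    rw [if_neg (by omega)]
  · intro k m
    split_ifs
    · rfl
    · simp

theorem summable_inv_sub_inv (b : ℕ) (hb : b ≤ 1) :
    Summable fun m : ℕ => ((2 * m + b : ℕ) : ℝ)⁻¹ - 2⁻¹ * (m : ℝ)⁻¹ := by
  refine (summable_nat_add_iff 1).1 (Summable.of_norm_bounded
    ((summable_nat_add_iff 1).2 (Real.summable_nat_pow_inv.2 one_lt_two)) fun m => ?_)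
  have hm : (0 : ℝ) < ((m + 1 : ℕ) : ℝ) := by positivity
  set x := ((m + 1 : ℕ) : ℝ) with hx
  have hb' : (b : ℝ) ≤ 1 := by exact_mod_cast hb
  have hb0 : (0 : ℝ) ≤ b := Nat.cast_nonneg b
  have hcast : ((2 * (m + 1) + b : ℕ) : ℝ) = 2 * x + b := by rw [hx]; push_cast; ring
  rw [hcast]
  have h : (2 * x + b)⁻¹ - 2⁻¹ * x⁻¹ = -(b / (2 * x * (2 * x + b))) := by
    field_simp
    ring
  rw [h, norm_neg, Real.norm_of_nonneg (by positivity), div_le_iff₀ (by positivity),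
    ← div_eq_inv_mul, le_div_iff₀ (by positivity)]
  nlinarith [mul_nonneg hm.le hb0, mul_nonneg (sub_nonneg.2 hb') (sq_nonneg x), sq_nonneg x]

/-- The defect of harmonic terms under appending a binary digit. -/
noncomputable def harmonicDefect (m : ℕ) : ℝ :=
  (m : ℝ)⁻¹ - ((2 * m : ℕ) : ℝ)⁻¹ - ((2 * m + 1 : ℕ) : ℝ)⁻¹

theorem summable_harmonicDefect : Summable harmonicDefect := by
  refine (summable_inv_sub_inv 1 le_rfl).neg.congr fun m => ?_
  unfold harmonicDefect
  push_cast
  rw [mul_inv]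
  ring

theorem sum_range_succ_harmonicDefect (M : ℕ) :
    ∑ m ∈ Finset.range (M + 1), harmonicDefect m =
      (harmonic M : ℝ) - (harmonic (2 * M) : ℝ) - ((2 * M + 1 : ℕ) : ℝ)⁻¹ := by
  induction M with
  | zero => simp [harmonicDefect]
  | succ M ih =>
    rw [Finset.sum_range_succ, ih, show 2 * (M + 1) = 2 * M + 1 + 1 by ring, harmonic_succ,
      harmonic_succ, harmonic_succ, harmonicDefect]
    push_cast
    ring

/-- The partial sums are `H_M - H_{2M} - 1/(2M+1)`. Because `0⁻¹ = 0`, the index `m = 0` contributes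
`-1`, from `n = 1`. -/
theorem tsum_harmonicDefect : ∑' m, harmonicDefect m = -Real.log 2 := by
  have h1 := (tendsto_add_atTop_iff_nat 1).2 summable_harmonicDefect.hasSum.tendsto_sum_nat
  refine tendsto_nhds_unique h1 ?_
  simp only [sum_range_succ_harmonicDefect]
  have hH := Real.tendsto_harmonic_sub_log
  have hdbl : Tendsto (fun M : ℕ => 2 * M) atTop atTop :=
    tendsto_id.const_mul_atTop' two_pos
  have hinv : Tendsto (fun M : ℕ => ((2 * M + 1 : ℕ) : ℝ)⁻¹) atTop (𝓝 0) :=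
    tendsto_inv_atTop_zero.comp (tendsto_natCast_atTop_atTop.comp
      (tendsto_atTop_mono (fun M => by simp only [id]; omega) tendsto_id))
  have h2 := ((hH.sub (hH.comp hdbl)).sub_const (Real.log 2)).sub hinv
  simp only [sub_self, zero_sub, sub_zero] at h2
  refine h2.congr' ?_
  filter_upwards [eventually_gt_atTop 0] with M hM
  have hM' : (M : ℝ) ≠ 0 := by exact_mod_cast hM.ne'
  simp only [Function.comp_apply]
  push_cast
  rw [Real.log_mul two_ne_zero hM']
  ring

/-! ### Level sums over the block's own residue class -/

/-- Passing from `n` to `n / 2` changes the level only inside the residue class of the block. -/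
theorem levelTerm_eq (ha : IsBlockCounter a r v) (q u k n : ℕ) :
    levelTerm a q u k n = (if n % q = u ∧ a (n / 2) = k then (n : ℝ)⁻¹ else 0) +
      ((if n % q = u then levelTerm a (2 ^ r) v k n else 0) -
        if n % q = u then levelTerm a (2 ^ r) v (k + 1) n else 0) := by
  unfold levelTerm
  rcases Nat.eq_zero_or_pos n with rfl | hn
  · simp
  · have h := ha n hn
    by_cases hq : n % q = u <;> by_cases hr : n % 2 ^ r = v
    · simp only [hq, hr, true_and, if_true] at h ⊢
      by_cases h1 : a n = k
      · rw [if_pos h1, if_neg (by omega), if_neg (by omega)]; ring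
      · by_cases h2 : a n = k + 1
        · rw [if_neg h1, if_pos (by omega), if_pos h2]; ring
        · rw [if_neg h1, if_neg (by omega), if_neg h2]; ring
    · simp only [hq, hr, true_and, false_and, if_true, if_false, add_zero] at h ⊢
      rw [h]; ring
    · simp [hq]
    · simp [hq]

theorem levelSum_zero_eq (ha : IsBlockCounter a r v) : levelSum a (2 ^ r) v 0 = 0 := by
  refine (tsum_congr fun n => ?_).trans tsum_zero
  unfold levelTerm
  rcases Nat.eq_zero_or_pos n with rfl | hn
  · simp
  · refine if_neg fun h => ?_
    have := ha n hn
    rw [if_pos h.1] at this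
    omega

theorem summable_ite_levelTerm (ha : IsBlockCounter a r v) (hv : v < 2 ^ r) (p : ℕ → Prop)
    [DecidablePred p] (q u k : ℕ) :
    Summable fun n => if p n then levelTerm a q u k n else 0 := by
  refine Summable.of_norm_bounded (ha.summable_levelTerm hv q u k).norm fun n => ?_
  split_ifs
  · rfl
  · simp

theorem summable_ite_div_two (ha : IsBlockCounter a r v) (hv : v < 2 ^ r) (q u k : ℕ) :
    Summable fun n : ℕ => if n % q = u ∧ a (n / 2) = k then (n : ℝ)⁻¹ else 0 := by
  refine ((ha.summable_levelTerm hv q u k).sub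
    ((ha.summable_ite_levelTerm hv (· % q = u) (2 ^ r) v k).sub
      (ha.summable_ite_levelTerm hv (· % q = u) (2 ^ r) v (k + 1)))).congr fun n => ?_
  rw [ha.levelTerm_eq q u k n]
  ring

theorem tsum_ite_levelTerm (a : ℕ → ℕ) {q Q : ℕ} (hq : q ∣ Q) (u v k : ℕ) :
    ∑' n, (if n % q = u then levelTerm a Q v k n else 0) =
      if v % q = u then levelSum a Q v k else 0 := by
  have hmod : ∀ n, n % Q = v → n % q = v % q := fun n hn => by
    rw [← hn, Nat.mod_mod_of_dvd n hq]
  unfold levelSum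
  split_ifs with h
  · refine tsum_congr fun n => ?_
    unfold levelTerm
    split_ifs with h1 h2 h2
    · rfl
    · rfl
    · exact absurd ((hmod n h2.1).trans h) h1
    · rfl
  · refine (tsum_congr fun n => ?_).trans tsum_zero
    unfold levelTerm
    split_ifs with h1 h2
    · exact absurd ((hmod n h2.1).symm.trans h1) h
    · rfl
    · rfl

theorem levelSum_eq (ha : IsBlockCounter a r v) (hv : v < 2 ^ r) {q : ℕ} (hq : q ∣ 2 ^ r)
    (u k : ℕ) :
    levelSum a q u k = ∑' n : ℕ, (if n % q = u ∧ a (n / 2) = k then (n : ℝ)⁻¹ else 0) +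
      ((if v % q = u then levelSum a (2 ^ r) v k else 0) -
        if v % q = u then levelSum a (2 ^ r) v (k + 1) else 0) := by
  have h1 := ha.summable_ite_levelTerm hv (· % q = u) (2 ^ r) v k
  have h2 := ha.summable_ite_levelTerm hv (· % q = u) (2 ^ r) v (k + 1)
  rw [← tsum_ite_levelTerm a hq, ← tsum_ite_levelTerm a hq, ← h1.tsum_sub h2,
    ← (ha.summable_ite_div_two hv q u k).tsum_add (h1.sub h2)]
  exact tsum_congr fun n => ha.levelTerm_eq q u k n

/-- Both sides compare the weight of the level `a n = k` with that of `a (n / 2) = k`; splitting the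
latter into even and odd `n` gives the right side. -/
theorem levelSum_sub_levelSum_succ (ha : IsBlockCounter a r v) (hv : v < 2 ^ r) (k : ℕ) :
    levelSum a (2 ^ r) v k - levelSum a (2 ^ r) v (k + 1) =
      ∑' m, if a m = k then harmonicDefect m else 0 := by
  have h1 := ha.levelSum_eq hv (one_dvd _) 0 k
  have hG := ha.summable_ite_div_two hv 1 0 k
  have hS := ha.summable_levelTerm hv 1 0 k
  rw [if_pos (Nat.mod_one v), if_pos (Nat.mod_one v)] at h1
  set g : ℕ → ℝ := fun n => if n % 1 = 0 ∧ a (n / 2) = k then (n : ℝ)⁻¹ else 0 with hg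
  have hGe : Summable fun m => g (2 * m) :=
    hG.comp_injective fun x y h => by simpa using h
  have hGo : Summable fun m => g (2 * m + 1) :=
    hG.comp_injective fun x y h => by simpa using h
  have h2 : levelSum a 1 0 k - ∑' n, g n =
      ∑' m, (levelTerm a 1 0 k m - (g (2 * m) + g (2 * m + 1))) := by
    rw [← tsum_even_add_odd hGe hGo, ← hGe.tsum_add hGo, levelSum, hS.tsum_sub (hGe.add hGo)]
  rw [h1, add_sub_cancel_left] at h2
  rw [h2]
  refine tsum_congr fun m => ?_
  simp only [hg, levelTerm, harmonicDefect, Nat.mod_one, true_and, show 2 * m / 2 = m by omega,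
    show (2 * m + 1) / 2 = m by omega]
  split_ifs
  · ring
  · ring

theorem levelSum_eq_neg_tsum (ha : IsBlockCounter a r v) (hv : v < 2 ^ r) (k : ℕ) :
    levelSum a (2 ^ r) v k = -∑' m, if a m < k then harmonicDefect m else 0 := by
  induction k with
  | zero => simp [ha.levelSum_zero_eq]
  | succ k ih =>
    have hs : ∀ (p : ℕ → Prop) [DecidablePred p],
        Summable fun m => if p m then harmonicDefect m else 0 := by
      intro p _
      refine Summable.of_norm_bounded summable_harmonicDefect.norm fun m => ?_
      split_ifs
      · rfl
      · simp
    have h := ha.levelSum_sub_levelSum_succ hv k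
    have hadd : ∑' m, (if a m < k + 1 then harmonicDefect m else 0) =
        ∑' m, (if a m < k then harmonicDefect m else 0) +
          ∑' m, if a m = k then harmonicDefect m else 0 := by
      rw [← (hs fun m => a m < k).tsum_add (hs fun m => a m = k)]
      refine tsum_congr fun m => ?_
      rcases lt_trichotomy (a m) k with h | h | h
      · rw [if_pos (by omega), if_pos h, if_neg (by omega), add_zero]
      · rw [if_pos (by omega), if_neg (by omega), if_pos h, zero_add]
      · rw [if_neg (by omega), if_neg (by omega), if_neg (by omega), add_zero]
    rw [hadd]
    linarith

/-- The sums over the residue class of the block itself converge to `log 2`. -/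
theorem tendsto_levelSum_block (ha : IsBlockCounter a r v) (hv : v < 2 ^ r) :
    Tendsto (levelSum a (2 ^ r) v) atTop (𝓝 (Real.log 2)) := by
  rw [← neg_neg (Real.log 2), ← tsum_harmonicDefect, funext (ha.levelSum_eq_neg_tsum hv)]
  refine (tendsto_tsum_of_dominated_convergence summable_harmonicDefect.norm (fun m => ?_)
    (Eventually.of_forall ?_)).neg
  · refine tendsto_const_nhds.congr' ?_
    filter_upwards [eventually_gt_atTop (a m)] with k hk
    rw [if_pos hk]
  · intro k m
    split_ifs
    · rfl
    · simp

/-! ### Equidistribution in residue classes -/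

theorem tsum_ite_mod_pow_succ (a : ℕ → ℕ) (j u k : ℕ) :
    ∑' n : ℕ, (if n % 2 ^ (j + 1) = u ∧ a (n / 2) = k then (n : ℝ)⁻¹ else 0) =
      ∑' m : ℕ, if m % 2 ^ j = u / 2 ∧ a m = k then ((2 * m + u % 2 : ℕ) : ℝ)⁻¹ else 0 := by
  have hb : u % 2 < 2 := Nat.mod_lt _ two_pos
  have hinj : Function.Injective fun m : ℕ => 2 * m + u % 2 := fun x y h => by
    simpa using h
  rw [← hinj.tsum_eq]
  · refine tsum_congr fun m => ?_
    have hd : (2 * m + u % 2) / 2 = m := by omega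
    have hm : (2 * m + u % 2) % 2 ^ (j + 1) = 2 * (m % 2 ^ j) + u % 2 := by
      rw [pow_succ', Nat.mod_mul, hd]
      omega
    have hiff : 2 * (m % 2 ^ j) + u % 2 = u ↔ m % 2 ^ j = u / 2 := by omega
    simp only [hd, hm, hiff]
  · intro n hn
    have h : n % 2 ^ (j + 1) = u := by
      by_contra h
      simp [h] at hn
    refine ⟨n / 2, ?_⟩
    have : u % 2 = n % 2 := by
      rw [← h, Nat.mod_mod_of_dvd n (dvd_pow_self 2 (Nat.succ_ne_zero j))]
    simp only [this]
    omega

/-- At high levels, the weights `1 / n` are equidistributed in the residue classes. -/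
theorem tendsto_mul_levelSum_sub (ha : IsBlockCounter a r v) (hv : v < 2 ^ r) {j : ℕ}
    (hj : j ≤ r) {u : ℕ} (hu : u < 2 ^ j) :
    Tendsto (fun k => 2 ^ j * levelSum a (2 ^ j) u k - levelSum a 1 0 k) atTop (𝓝 0) := by
  induction j generalizing u with
  | zero =>
    obtain rfl : u = 0 := by simpa using hu
    simp
  | succ j ih =>
    have ih' := ih (Nat.le_of_succ_le hj) (u := u / 2) (by rw [pow_succ] at hu; omega)
    have hb : u % 2 ≤ 1 := by omega
    have hT := ha.tendsto_levelSum_block hv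
    -- Consecutive block sums share the limit `log 2`, so the level correction vanishes.
    have hdiff : Tendsto (fun k => (if v % 2 ^ (j + 1) = u then levelSum a (2 ^ r) v k else 0) -
        if v % 2 ^ (j + 1) = u then levelSum a (2 ^ r) v (k + 1) else 0) atTop (𝓝 0) := by
      by_cases h : v % 2 ^ (j + 1) = u
      · simpa only [h, if_true, sub_self] using hT.sub ((tendsto_add_atTop_iff_nat 1).2 hT)
      · simp [h]
    -- Replacing `1/(2m+b)` by `1/(2m)` costs a summable error, negligible on high levels.
    have herr := tendsto_tsum_level_zero a (summable_inv_sub_inv (u % 2) hb)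
      (fun m => m % 2 ^ j = u / 2)
    have hlim := ((hdiff.add herr).const_mul (2 ^ (j + 1))).add ih'
    simp only [add_zero, mul_zero] at hlim
    refine hlim.congr fun k => ?_
    have hsum : ∑' n : ℕ, (if n % 2 ^ (j + 1) = u ∧ a (n / 2) = k then (n : ℝ)⁻¹ else 0) =
        ∑' m : ℕ, (if m % 2 ^ j = u / 2 ∧ a m = k then
          ((2 * m + u % 2 : ℕ) : ℝ)⁻¹ - 2⁻¹ * (m : ℝ)⁻¹ else 0) +
          2⁻¹ * levelSum a (2 ^ j) (u / 2) k := by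
      have hs := ha.summable_levelTerm hv (2 ^ j) (u / 2) k
      have hs' : Summable fun m : ℕ => if m % 2 ^ j = u / 2 ∧ a m = k then
          ((2 * m + u % 2 : ℕ) : ℝ)⁻¹ - 2⁻¹ * (m : ℝ)⁻¹ else 0 := by
        refine Summable.of_norm_bounded (summable_inv_sub_inv (u % 2) hb).norm fun m => ?_
        split_ifs
        · rfl
        · simp
      rw [tsum_ite_mod_pow_succ, levelSum, ← tsum_mul_left, ← hs'.tsum_add (hs.mul_left 2⁻¹)]
      refine tsum_congr fun m => ?_
      unfold levelTerm
      split_ifs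
      · ring
      · ring
    rw [ha.levelSum_eq hv (pow_dvd_pow 2 hj) u k, hsum]
    ring

theorem tendsto_levelSum (ha : IsBlockCounter a r v) (hv : v < 2 ^ r) :
    Tendsto (levelSum a 1 0) atTop (𝓝 (2 ^ r * Real.log 2)) := by
  have h := ((ha.tendsto_levelSum_block hv).const_mul (2 ^ r)).sub
    (ha.tendsto_mul_levelSum_sub hv le_rfl hv)
  rw [sub_zero] at h
  exact h.congr fun k => by ring

end IsBlockCounter

/-! ### Application to word counts -/

theorem exists_isBlockCounter_wordCount (w : List Bool) :
    ∃ v < 2 ^ w.length, IsBlockCounter (wordCount w) w.length v := by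
  obtain ⟨v, hv, h⟩ := exists_occursAt_zero_iff w
  refine ⟨v, hv, fun n hn => ?_⟩
  rw [wordCount_eq_wordCount_div_two_add w hn]
  simp only [h]

theorem indicator_one_div_eq_levelTerm (a : ℕ → ℕ) (k : ℕ) :
    Set.indicator {n | 1 ≤ n ∧ a n = k} (fun n : ℕ => 1 / (n : ℝ)) = levelTerm a 1 0 k := by
  ext n
  rcases Nat.eq_zero_or_pos n with rfl | hn
  · simp [levelTerm]
  · simp [levelTerm, Set.indicator_apply, Nat.mod_one, Nat.one_le_iff_ne_zero, hn.ne']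

theorem summable_wordCount_level (w : List Bool) (k : ℕ) :
    Summable fun n : {n : ℕ // 1 ≤ n ∧ wordCount w n = k} => 1 / ((n : ℕ) : ℝ) := by
  obtain ⟨v, hv, ha⟩ := exists_isBlockCounter_wordCount w
  refine (summable_subtype_iff_indicator (s := {n | 1 ≤ n ∧ wordCount w n = k})
    (f := fun n : ℕ => 1 / (n : ℝ))).2 ?_
  rw [indicator_one_div_eq_levelTerm]
  exact ha.summable_levelTerm hv 1 0 k

theorem tendsto_tsum_wordCount_level (w : List Bool) :
    Tendsto (fun k : ℕ => ∑' n : {n : ℕ // 1 ≤ n ∧ wordCount w n = k}, 1 / ((n : ℕ) : ℝ))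
      atTop (𝓝 (2 ^ w.length * Real.log 2)) := by
  obtain ⟨v, hv, ha⟩ := exists_isBlockCounter_wordCount w
  refine (ha.tendsto_levelSum hv).congr fun k => ?_
  rw [levelSum, ← indicator_one_div_eq_levelTerm]
  exact (tsum_subtype {n | 1 ≤ n ∧ wordCount w n = k} fun n : ℕ => 1 / (n : ℝ)).symm

theorem theorem3 :
    (∀ (r : ℕ) (w : List Bool), w.length = r →
      (∀ k : ℕ, Summable fun n : {n : ℕ // 1 ≤ n ∧ wordCount w n = k} => 1 / ((n : ℕ) : ℝ)) ∧
      Filter.Tendsto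
        (fun k : ℕ => ∑' n : {n : ℕ // 1 ≤ n ∧ wordCount w n = k}, 1 / ((n : ℕ) : ℝ))
        Filter.atTop (nhds ((2 : ℝ) ^ r * Real.log 2))) ∧
    Filter.Tendsto
      (fun k : ℕ => ∑' n : {n : ℕ // 1 ≤ n ∧ wordCount [true, true] n = k}, 1 / ((n : ℕ) : ℝ))
      Filter.atTop (nhds (4 * Real.log 2)) := by
  refine ⟨?_, ?_⟩
  · rintro r w rfl
    exact ⟨summable_wordCount_level w, tendsto_tsum_wordCount_level w⟩
  · have h := tendsto_tsum_wordCount_level [true, true]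
    norm_num at h ⊢
    exact h
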